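/- Let $t$ be an indeterminate, put $k=t^2+1$, and let $m\ge 1$ be an integer. The equation $$x^2+k^n=\frac{k^2}{4(k-1)}\left(k^{2m+2}+2(k-2)k^m+1\right),$$ treated as an equation in polynomials, has, up to replacing $x$ by $-x$, exactly three solutions $(x,n)$ with $x\in\mathbb{Q}[t]$ and $n\in\mathbb{N}=\{0,1,2,\dots\}$, one for each of $n=0$, $n=m+2$ and $n=2m+2$. In all of these solutions $x$ is integer-valued, that is, $x(a)\in\mathbb{Z}$ for every $a\in\mathbb{Z}$. -/

import Mathlib

open Polynomial

noncomputable section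

/-- The polynomial `k = t² + 1`, seen in the field of rational functions `ℚ(t)`. -/
def kRat : RatFunc ℚ := RatFunc.X ^ 2 + 1

/-- The right-hand side `k² / (4 (k - 1)) * (k ^ (2m+2) + 2 (k - 2) k ^ m + 1)`, formed in `ℚ(t)`,
where `k - 1 = t²` is invertible. -/
def rhsRat (m : ℕ) : RatFunc ℚ :=
  kRat ^ 2 / (4 * (kRat - 1)) * (kRat ^ (2 * m + 2) + 2 * (kRat - 2) * kRat ^ m + 1)

/-- The pair `(x, n) ∈ ℚ[t] × ℕ` solves the equation with parameter `m`. -/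
def IsSolution (m : ℕ) (x : ℚ[X]) (n : ℕ) : Prop :=
  (algebraMap ℚ[X] (RatFunc ℚ) x) ^ 2 + kRat ^ n = rhsRat m

/-- The polynomial `x ∈ ℚ[t]` takes integer values at all integers. -/
def IsIntegerValued (x : ℚ[X]) : Prop :=
  ∀ a : ℤ, ∃ b : ℤ, x.eval (a : ℚ) = (b : ℚ)

end

/-! Clear denominators and work modulo the prime `k`. If `n ≥ 1` then `k` divides `2tx`, and `n = 1`
is impossible since `k ∤ 4t²`. So `2tx = kz` with `z² = k^(2m+2) + 2(k-2)k^m + 1 - 4(k-1)k^N`, `N =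
n - 2`. A sign at `t = 2` gives `N ≤ 2m` (`le_of_sq_eq`). Degrees and congruences modulo `k^m` then
force `z = ±k^(m+1) + c` unless `N = 2m`, and comparing coefficients in `k` leaves only `N = m`
(`eq_or_eq_of_sq_eq`). -/

/-- The half-integral multiple `X * (X² + 1) * q / 2` of an integral polynomial `q` takes integer
values at the integers. -/
theorem isIntegerValued_half (q : ℤ[X]) :
    IsIntegerValued (C (1 / 2) * X * (X ^ 2 + 1) * q.map (Int.castRingHom ℚ)) := by
  intro a
  have h2 : Even (a * (a ^ 2 + 1)) := by
    rcases Int.even_or_odd a with h | h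
    · exact h.mul_right _
    · exact ((h.pow).add_odd odd_one).mul_left _
  obtain ⟨b, hb⟩ := h2
  refine ⟨b * q.eval a, ?_⟩
  have hq : (q.map (Int.castRingHom ℚ)).eval (a : ℚ) = ((q.eval a : ℤ) : ℚ) := by
    exact Polynomial.eval_intCast_map (Int.castRingHom ℚ) q a
  have hb' : (a : ℚ) * ((a : ℚ) ^ 2 + 1) = b + b := by exact_mod_cast hb
  simp only [eval_mul, eval_C, eval_X, eval_add, eval_pow, eval_one, hq]
  push_cast
  linear_combination (1 / 2 : ℚ) * ((q.eval a : ℤ) : ℚ) * hb'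

theorem IsIntegerValued.X_add {p : ℚ[X]} (hp : IsIntegerValued p) : IsIntegerValued (X + p) := by
  intro a
  obtain ⟨b, hb⟩ := hp a
  exact ⟨a + b, by simp [hb]⟩

/-- The equation, with denominators cleared, in `ℚ[t]`. -/
theorem isSolution_iff (m : ℕ) (x : ℚ[X]) (n : ℕ) :
    IsSolution m x n ↔ (2 * X * x) ^ 2 + 4 * X ^ 2 * (X ^ 2 + 1) ^ n =
      (X ^ 2 + 1) ^ 2 * ((X ^ 2 + 1) ^ (2 * m + 2)
        + 2 * (X ^ 2 - 1) * (X ^ 2 + 1) ^ m + 1) := by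
  have hX : (RatFunc.X : RatFunc ℚ) ≠ 0 := RatFunc.X_ne_zero
  have hX2 : (4 * (kRat - 1) : RatFunc ℚ) ≠ 0 := by
    have : (4 * (kRat - 1) : RatFunc ℚ) = (2 * RatFunc.X) ^ 2 := by
      unfold kRat; ring
    rw [this]
    exact pow_ne_zero _ (mul_ne_zero two_ne_zero hX)
  have hinj := IsFractionRing.injective ℚ[X] (RatFunc ℚ)
  rw [← hinj.eq_iff]
  unfold IsSolution rhsRat
  rw [div_mul_eq_mul_div, eq_div_iff hX2]
  simp only [map_add, map_mul, map_pow, map_sub, map_one, map_ofNat, RatFunc.algebraMap_X, kRat]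
  constructor <;> intro h <;> linear_combination h

theorem natDegree_X_sq_add_one : (X ^ 2 + 1 : ℚ[X]).natDegree = 2 := by
  compute_degree!

theorem prime_X_sq_add_one : Prime (X ^ 2 + 1 : ℚ[X]) := by
  rw [← irreducible_iff_prime]
  refine (Polynomial.irreducible_iff_roots_eq_zero_of_degree_le_three
    (by rw [natDegree_X_sq_add_one]) (by rw [natDegree_X_sq_add_one]; norm_num)).2 ?_
  refine Multiset.eq_zero_of_forall_notMem fun a ha => ?_
  have h := (Polynomial.mem_roots'.1 ha).2
  simp only [IsRoot.def, eval_add, eval_pow, eval_X, eval_one] at h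
  nlinarith [sq_nonneg a]

/-- Since `k` is nonconstant, an identity in `t` involving only `k` may be compared coefficientwise
in `k`. -/
theorem comp_X_sq_add_one_injective {p : ℚ[X]} (h : p.comp (X ^ 2 + 1) = 0) : p = 0 := by
  rcases Polynomial.comp_eq_zero_iff.1 h with h | ⟨-, h⟩
  · exact h
  · have := congrArg natDegree h
    rw [natDegree_X_sq_add_one, natDegree_C] at this
    omega

/-- If `z² - w²` has degree at most `deg w + d`, then `z` agrees up to sign with `w` up to a term
of degree at most `d`. -/
theorem natDegree_sub_or_add_le {z w : ℚ[X]} {d : ℕ}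
    (h : (z ^ 2 - w ^ 2).natDegree ≤ w.natDegree + d) :
    (z - w).natDegree ≤ d ∨ (z + w).natDegree ≤ d := by
  by_contra! hc
  obtain ⟨h1, h2⟩ := hc
  have hz1 : z - w ≠ 0 := by rintro h0; simp [h0] at h1
  have hz2 : z + w ≠ 0 := by rintro h0; simp [h0] at h2
  rw [show z ^ 2 - w ^ 2 = (z - w) * (z + w) by ring, natDegree_mul hz1 hz2] at h
  have hd : w.natDegree ≤ max (z + w).natDegree (z - w).natDegree := by
    have h3 : ((z + w) - (z - w)).natDegree = w.natDegree := by
      rw [show (z + w) - (z - w) = C 2 * w by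
        rw [show (C 2 : ℚ[X]) = 2 from rfl]; ring]
      exact natDegree_C_mul two_ne_zero
    rw [← h3]
    exact natDegree_sub_le _ _
  rcases le_max_iff.1 hd with h3 | h3 <;> omega

/-- The polynomial identity in `k` that results when the square root is `±k^(m+1) + c`. -/
theorem comp_eq_zero_of_sq_eq {m N : ℕ} {z : ℚ[X]} {c : ℚ} {s : ℚ}
    (hs : s ^ 2 = 1) (hz : z = C s * (X ^ 2 + 1) ^ (m + 1) + C c)
    (h : z ^ 2 = (X ^ 2 + 1) ^ (2 * m + 2) + 2 * (X ^ 2 - 1) * (X ^ 2 + 1) ^ m + 1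
      - 4 * X ^ 2 * (X ^ 2 + 1) ^ N) :
    (C (2 * s * c - 2) * X ^ (m + 1) + C 4 * X ^ m + C 4 * X ^ (N + 1) - C 4 * X ^ N
      + C (c ^ 2 - 1) : ℚ[X]) = 0 := by
  apply comp_X_sq_add_one_injective
  have hs' : (C s : ℚ[X]) ^ 2 = 1 := by rw [← C_pow, hs, C_1]
  subst hz
  have h4 : (C 4 : ℚ[X]) = 4 := rfl
  have h2 : (C 2 : ℚ[X]) = 2 := rfl
  simp only [add_comp, sub_comp, mul_comp, C_comp, pow_comp, X_comp]
  simp only [map_sub, map_mul, map_pow, map_one, h4, h2]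
  linear_combination h - (X ^ 2 + 1) ^ (2 * m + 2) * hs'

/-- The only exponents `N` for which the reduced right-hand side is a square are `m` and `2 m`. -/
theorem eq_or_eq_of_sq_eq {m N : ℕ} (hm : 1 ≤ m) (hN : N ≤ 2 * m) {z : ℚ[X]}
    (h : z ^ 2 = (X ^ 2 + 1) ^ (2 * m + 2) + 2 * (X ^ 2 - 1) * (X ^ 2 + 1) ^ m + 1
      - 4 * X ^ 2 * (X ^ 2 + 1) ^ N) : N = m ∨ N = 2 * m := by
  by_contra! hc
  obtain ⟨hNm, hN2⟩ := hc
  have hdw : ((X ^ 2 + 1 : ℚ[X]) ^ (m + 1)).natDegree = 2 * (m + 1) := by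
    rw [natDegree_pow, natDegree_X_sq_add_one]; ring
  have hdiff : z ^ 2 - ((X ^ 2 + 1) ^ (m + 1)) ^ 2 =
      2 * (X ^ 2 - 1) * (X ^ 2 + 1) ^ m + 1 - 4 * X ^ 2 * (X ^ 2 + 1) ^ N := by
    rw [h]; ring
  have hkd : ∀ j : ℕ, ((X ^ 2 + 1 : ℚ[X]) ^ j).natDegree ≤ 2 * j := fun j => by
    rw [natDegree_pow, natDegree_X_sq_add_one]; omega
  -- Truncated subtraction is intended: for `N < m` the bound is `deg w` itself, so the difference
  -- below is constant.
  have hdeg : (z ^ 2 - ((X ^ 2 + 1) ^ (m + 1)) ^ 2).natDegree ≤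
      ((X ^ 2 + 1 : ℚ[X]) ^ (m + 1)).natDegree + 2 * (N - m) := by
    rw [hdiff, hdw]
    have e1 : (2 * (X ^ 2 - 1) : ℚ[X]).natDegree ≤ 2 := by compute_degree
    have e2 : (4 * X ^ 2 : ℚ[X]).natDegree ≤ 2 := by compute_degree
    refine natDegree_sub_le_of_le (natDegree_add_le_of_degree_le
      ((natDegree_mul_le_of_le e1 (hkd m)).trans ?_) (by simp))
      ((natDegree_mul_le_of_le e2 (hkd N)).trans ?_) |>.trans (max_self _).le <;> omega
  obtain ⟨s, c, hs, hz⟩ : ∃ s c : ℚ, s ^ 2 = 1 ∧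
      z = C s * (X ^ 2 + 1) ^ (m + 1) + C c := by
    have key : ∃ s : ℚ, s ^ 2 = 1 ∧
        (z - C s * (X ^ 2 + 1) ^ (m + 1)).natDegree ≤ 2 * (N - m) := by
      rcases natDegree_sub_or_add_le hdeg with h1 | h1
      · exact ⟨1, by norm_num, by simpa using h1⟩
      · exact ⟨-1, by norm_num, by simpa using h1⟩
    obtain ⟨s, hs, hsd⟩ := key
    suffices ∃ c : ℚ, z - C s * (X ^ 2 + 1) ^ (m + 1) = C c by
      obtain ⟨c, hc⟩ := this
      exact ⟨s, c, hs, by linear_combination hc⟩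
    rcases lt_or_gt_of_ne hNm with hlt | hgt
    · rw [Nat.sub_eq_zero_of_le hlt.le, mul_zero] at hsd
      exact ⟨_, eq_C_of_natDegree_le_zero hsd⟩
    · obtain ⟨e, rfl⟩ := Nat.exists_eq_add_of_lt hgt
      have hdvd : (X ^ 2 + 1 : ℚ[X]) ^ m ∣ (z - 1) * (z + 1) :=
        ⟨2 * (X ^ 2 - 1) - 4 * X ^ 2 * (X ^ 2 + 1) ^ (e + 1) + (X ^ 2 + 1) ^ (m + 2), by
          linear_combination h⟩
      -- The factors differ by the unit `2`, so `k` divides at most one of them and the other takes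
      -- all of `k^m`.
      have hcase : (X ^ 2 + 1 : ℚ[X]) ^ m ∣ z - 1 ∨ (X ^ 2 + 1 : ℚ[X]) ^ m ∣ z + 1 := by
        have hp := prime_X_sq_add_one
        by_cases h1 : (X ^ 2 + 1 : ℚ[X]) ∣ z - 1
        · refine Or.inl (hp.pow_dvd_of_dvd_mul_right m (fun h2 => hp.not_isUnit ?_) hdvd)
          have h3 : (X ^ 2 + 1 : ℚ[X]) ∣ C 2 := by
            have := dvd_sub h2 h1
            rwa [show z + 1 - (z - 1) = C 2 by
              rw [show (C 2 : ℚ[X]) = 2 from rfl]; ring] at this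
          exact isUnit_of_dvd_unit h3 (isUnit_C.2 (by norm_num))
        · exact Or.inr (hp.pow_dvd_of_dvd_mul_left m h1 hdvd)
      obtain ⟨c, hc⟩ : ∃ c : ℚ, (X ^ 2 + 1 : ℚ[X]) ^ m ∣ z - C c := by
        rcases hcase with h1 | h1
        · exact ⟨1, by simpa using h1⟩
        · exact ⟨-1, by simpa using h1⟩
      -- `k^m` divides `z - s k^(m+1) - c`, whose degree is at most `2(N - m) < 2m`.
      refine ⟨c, sub_eq_zero.1 (eq_zero_of_dvd_of_natDegree_lt (p := (X ^ 2 + 1) ^ m) ?_ ?_)⟩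
      · have := dvd_sub hc (Dvd.intro_left (C s * (X ^ 2 + 1))
          (show C s * (X ^ 2 + 1) * (X ^ 2 + 1 : ℚ[X]) ^ m = C s * (X ^ 2 + 1) ^ (m + 1) by ring))
        rwa [sub_right_comm] at this
      · rw [natDegree_pow, natDegree_X_sq_add_one, natDegree_sub_C]
        omega
  have hP := comp_eq_zero_of_sq_eq hs hz h
  have hcoeff (j : ℕ) := congrArg (fun p : ℚ[X] => p.coeff j) hP
  simp only [coeff_add, coeff_sub, coeff_C_mul, coeff_X_pow, coeff_C, coeff_zero] at hcoeff
  rcases lt_or_gt_of_ne hNm with hlt | hgt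
  -- For `N = 0` the constant `c² - 1` could cancel the `-4`, so the coefficient of `k` is used
  -- instead.
  · rcases Nat.eq_zero_or_pos N with rfl | hpos
    · have h1 := hcoeff 1
      rw [if_neg (by omega : ¬ 1 = m + 1), if_neg (by omega : ¬ 1 = 0)] at h1
      split_ifs at h1 <;> norm_num at *
    · have h1 := hcoeff N
      rw [if_neg (by omega : ¬ N = m + 1), if_neg (by omega : ¬ N = m),
        if_neg (by omega : ¬ N = N + 1), if_pos rfl, if_neg (by omega : ¬ N = 0)] at h1
      norm_num at h1
  · have h1 := hcoeff m
    rw [if_neg (by omega : ¬ m = m + 1), if_pos rfl, if_neg (by omega : ¬ m = N + 1),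
      if_neg (by omega : ¬ m = N), if_neg (by omega : ¬ m = 0)] at h1
    norm_num at h1

/-- For larger exponents the leading coefficient of the reduced right-hand side is negative. -/
theorem le_of_sq_eq {m N : ℕ} (hm : 1 ≤ m) {z : ℚ[X]}
    (h : z ^ 2 = (X ^ 2 + 1) ^ (2 * m + 2) + 2 * (X ^ 2 - 1) * (X ^ 2 + 1) ^ m + 1
      - 4 * X ^ 2 * (X ^ 2 + 1) ^ N) : N ≤ 2 * m := by
  by_contra! hN
  -- At `t = 2`, with `q = 5^m`, the right side is at most `25q² + 6q + 1 - 80q² < 0`.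
  have key := congrArg (eval 2) h
  simp only [eval_sub, eval_add, eval_mul, eval_pow, eval_X, eval_one, eval_ofNat] at key
  norm_num at key
  have h1 : (5 : ℚ) ^ (2 * m + 1) ≤ 5 ^ N := pow_le_pow_right₀ (by norm_num) hN
  have h2 : (5 : ℚ) ≤ 5 ^ m := by simpa using pow_le_pow_right₀ (by norm_num : (1 : ℚ) ≤ 5) hm
  have h3 : (5 : ℚ) ^ (2 * m + 1) = 5 * (5 ^ m) ^ 2 := by ring
  have h4 : (5 : ℚ) ^ (2 * m + 2) = 25 * (5 ^ m) ^ 2 := by ring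
  nlinarith [sq_nonneg (eval 2 z)]

/-- The only exponents for which the cleared right-hand side is a square. -/
theorem exponent_of_sq_eq {m n : ℕ} (hm : 1 ≤ m) {y : ℚ[X]}
    (h : y ^ 2 + 4 * X ^ 2 * (X ^ 2 + 1) ^ n =
      (X ^ 2 + 1) ^ 2 * ((X ^ 2 + 1) ^ (2 * m + 2)
        + 2 * (X ^ 2 - 1) * (X ^ 2 + 1) ^ m + 1)) :
    n = 0 ∨ n = m + 2 ∨ n = 2 * m + 2 := by
  have hp := prime_X_sq_add_one
  have hX : ¬ (X ^ 2 + 1 : ℚ[X]) ∣ 4 * X ^ 2 := by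
    intro hd
    have h1 : (X ^ 2 + 1 : ℚ[X]) ∣ C 4 := by
      have := dvd_sub (Dvd.intro_left 4 (rfl : 4 * (X ^ 2 + 1 : ℚ[X]) = _)) hd
      rwa [show 4 * (X ^ 2 + 1 : ℚ[X]) - 4 * X ^ 2 = C 4 by
        rw [show (C 4 : ℚ[X]) = 4 from rfl]; ring] at this
    exact hp.not_isUnit (isUnit_of_dvd_unit h1 (isUnit_C.2 (by norm_num)))
  rcases Nat.eq_zero_or_pos n with h0 | hpos
  · exact Or.inl h0
  have hky : (X ^ 2 + 1 : ℚ[X]) ∣ y := by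
    refine hp.dvd_of_dvd_pow (n := 2) ?_
    obtain ⟨j, rfl⟩ := Nat.exists_eq_succ_of_ne_zero hpos.ne'
    exact ⟨(X ^ 2 + 1) * ((X ^ 2 + 1) ^ (2 * m + 2)
      + 2 * (X ^ 2 - 1) * (X ^ 2 + 1) ^ m + 1) - 4 * X ^ 2 * (X ^ 2 + 1) ^ j, by
        rw [Nat.succ_eq_add_one] at h; linear_combination h⟩
  obtain ⟨z, rfl⟩ := hky
  rcases Nat.lt_or_ge n 2 with h2 | h2
  · obtain rfl : n = 1 := by omega
    refine absurd ⟨(X ^ 2 + 1) ^ (2 * m + 2)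
      + 2 * (X ^ 2 - 1) * (X ^ 2 + 1) ^ m + 1 - z ^ 2, ?_⟩ hX
    apply mul_left_cancel₀ hp.ne_zero
    linear_combination h
  obtain ⟨N, rfl⟩ := Nat.exists_eq_add_of_le' h2
  have hz : z ^ 2 = (X ^ 2 + 1) ^ (2 * m + 2) + 2 * (X ^ 2 - 1) * (X ^ 2 + 1) ^ m + 1
      - 4 * X ^ 2 * (X ^ 2 + 1) ^ N := by
    apply mul_left_cancel₀ (pow_ne_zero 2 hp.ne_zero)
    linear_combination h
  have hN : N ≤ 2 * m := le_of_sq_eq hm hz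
  rcases eq_or_eq_of_sq_eq hm hN hz with h3 | h3 <;> omega

theorem mainTheorem4 (m : ℕ) (hm : 1 ≤ m) :
    ∃ x₁ x₂ x₃ : ℚ[X],
      IsIntegerValued x₁ ∧ IsIntegerValued x₂ ∧ IsIntegerValued x₃ ∧
      ∀ (x : ℚ[X]) (n : ℕ), IsSolution m x n ↔
        ((x = x₁ ∨ x = -x₁) ∧ n = 0) ∨
        ((x = x₂ ∨ x = -x₂) ∧ n = m + 2) ∨
        ((x = x₃ ∨ x = -x₃) ∧ n = 2 * m + 2) := by
  -- The geometric sum is `(k^j - 1)/t²`, as `k - 1 = t²`.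
  let S (j : ℕ) : ℤ[X] := ∑ i ∈ Finset.range j, (X ^ 2 + 1) ^ i
  let T (j : ℕ) : ℚ[X] := (S j).map (Int.castRingHom ℚ)
  have hT (j : ℕ) : X ^ 2 * T j = (X ^ 2 + 1) ^ j - 1 := by
    have h := geom_sum_mul (X ^ 2 + 1 : ℚ[X]) j
    have hTj : T j = ∑ i ∈ Finset.range j, (X ^ 2 + 1 : ℚ[X]) ^ i := by
      simp [T, S, Polynomial.map_sum]
    rw [hTj]
    linear_combination h
  have hC : 2 * C (1 / 2 : ℚ) = 1 := by
    rw [show (2 : ℚ[X]) = C 2 from rfl, ← C_mul]; norm_num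
  -- The square roots divided by `2t`: `k^(m+2) + k - 2 = k(k^(m+1) - 1) + 2t²`, `k(k^(m+1) - 1)`,
  -- and `k^(m+1)(k - 2) + k = t²k^(m+1) - k(k^m - 1)`.
  let x₁ : ℚ[X] := X + C (1 / 2) * X * (X ^ 2 + 1) * (S (m + 1)).map (Int.castRingHom ℚ)
  let x₂ : ℚ[X] := C (1 / 2) * X * (X ^ 2 + 1) * (S (m + 1)).map (Int.castRingHom ℚ)
  let x₃ : ℚ[X] := C (1 / 2) * X * (X ^ 2 + 1) *
    ((X ^ 2 + 1) ^ m - S m).map (Int.castRingHom ℚ)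
  have h₁ : 2 * X * x₁ = (X ^ 2 + 1) ^ (m + 2) + X ^ 2 - 1 := by
    linear_combination X ^ 2 * (X ^ 2 + 1) * T (m + 1) * hC + (X ^ 2 + 1) * hT (m + 1)
  have h₂ : 2 * X * x₂ = (X ^ 2 + 1) ^ (m + 2) - (X ^ 2 + 1) := by
    linear_combination X ^ 2 * (X ^ 2 + 1) * T (m + 1) * hC + (X ^ 2 + 1) * hT (m + 1)
  have h₃ : 2 * X * x₃ = (X ^ 2 + 1) ^ (m + 1) * (X ^ 2 - 1) + (X ^ 2 + 1) := by
    have : x₃ = C (1 / 2) * X * (X ^ 2 + 1) * ((X ^ 2 + 1) ^ m - T m) := by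
      simp [x₃, T]
    rw [this]
    linear_combination X ^ 2 * (X ^ 2 + 1) * ((X ^ 2 + 1) ^ m - T m) * hC
      - (X ^ 2 + 1) * hT m
  have hsq (x x' : ℚ[X]) : (2 * X * x) ^ 2 = (2 * X * x') ^ 2 ↔ x = x' ∨ x = -x' := by
    have h2X : (2 * X : ℚ[X]) ^ 2 ≠ 0 := pow_ne_zero _ (mul_ne_zero two_ne_zero X_ne_zero)
    rw [mul_pow, mul_pow _ x', mul_right_inj' h2X, sq_eq_sq_iff_eq_or_eq_neg]
  refine ⟨x₁, x₂, x₃, (isIntegerValued_half _).X_add, isIntegerValued_half _,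
    isIntegerValued_half _, fun x n => ?_⟩
  rw [isSolution_iff, ← hsq, ← hsq, ← hsq, h₁, h₂, h₃]
  constructor
  · intro h
    rcases exponent_of_sq_eq hm h with rfl | rfl | rfl
    · exact Or.inl ⟨by linear_combination h, rfl⟩
    · exact Or.inr (Or.inl ⟨by linear_combination h, rfl⟩)
    · exact Or.inr (Or.inr ⟨by linear_combination h, rfl⟩)
  · rintro (⟨h, rfl⟩ | ⟨h, rfl⟩ | ⟨h, rfl⟩) <;> linear_combination h
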